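/- A (non-trivial) planar doodle diagram is a finite connected 4-valent graph $D$ with at least one vertex (crossing), loops and multiple edges allowed, embedded in the sphere $S^2$. It defines a cell subdivision of $S^2$ with the crossings as 0-cells, the edges as 1-cells and the components of $S^2\setminus D$, called the regions, as 2-cells; it is recorded by its finite set of darts (oriented edges), the reversal of darts and the cyclic order of the darts around each crossing, the sphere being characterised by Euler characteristic $2$. The diagram is minimal if no region is a monogon or a bigon, that is, no region has a boundary curve of exactly one or exactly two edges. A graph is $k$-connected if it has more than $k$ vertices and is not disconnected by the removal of fewer than $k$ vertices. A diagram is called prime if its graph is 3-connected. **Theorem.** Let $D$ be a minimal planar doodle diagram whose graph is 2-connected. Then $D$ is prime if and only if for every two distinct regions $R\ne S$ of $D$ the intersection $\overline R\cap\overline S$ of their closures is empty, or consists of exactly one crossing, or is exactly one closed edge (an edge together with its end points). -/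

import Mathlib

/-- A graph is `k`-connected if it has more than `k` vertices and is not disconnected by the
removal of fewer than `k` vertices. -/
def IsKConnected {V : Type*} (G : SimpleGraph V) (k : ℕ) : Prop :=
  k < Nat.card V ∧ ∀ X : Finset V, X.card < k → (G.induce {v | v ∉ X}).Connected

/-- A cell subdivision of a closed oriented surface, recorded by its finite set `D` of darts
(oriented edges): `rev` reverses a dart, and `next` sends a dart to the next one, in
counterclockwise order, among the darts issuing from the same vertex. -/
structure CellMap (D : Type*) where
  next : Equiv.Perm D
  rev : Equiv.Perm D
  rev_rev : ∀ d, rev (rev d) = d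
  rev_ne : ∀ d, rev d ≠ d

namespace CellMap

variable {D : Type*} (M : CellMap D)

/-- The dart that follows `d` on the boundary of the region to the left of `d`: go to the end
of `d` and turn as sharply to the left as possible. -/
def walk : Equiv.Perm D := M.rev.trans M.next.symm

/-- Vertices (crossings): the cycles of `next`. -/
def Vertex : Type _ := Quotient (Equiv.Perm.SameCycle.setoid M.next)

/-- Edges: the two-element cycles of `rev`. -/
def Edge : Type _ := Quotient (Equiv.Perm.SameCycle.setoid M.rev)

/-- Regions (2-cells): the cycles of `walk`, i.e. the boundary curves of the 2-cells. -/
def Region : Type _ := Quotient (Equiv.Perm.SameCycle.setoid M.walk)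

/-- The vertex from which a dart issues. -/
def origin (d : D) : M.Vertex := Quotient.mk _ d

/-- The edge that carries a dart. -/
def edgeOf (d : D) : M.Edge := Quotient.mk _ d

/-- The region to the left of a dart. -/
def leftRegion (d : D) : M.Region := Quotient.mk _ d

/-- Adjacency of vertices in the 1-skeleton. Loops and multiple edges may occur in the
1-skeleton; they do not affect its connectivity. -/
def graph : SimpleGraph M.Vertex where
  Adj u v := u ≠ v ∧ ∃ d, M.origin d = u ∧ M.origin (M.rev d) = v
  symm := ⟨by
    rintro u v ⟨h, d, rfl, rfl⟩
    exact ⟨h.symm, M.rev d, rfl, by rw [M.rev_rev]⟩⟩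
  loopless := ⟨fun _ h => h.1 rfl⟩

/-- The number of edge-ends at a vertex. -/
noncomputable def valency (v : M.Vertex) : ℕ := {d | M.origin d = v}.ncard

/-- The number of edges in the boundary curve of a region: the region is an `i`-gon for this
number `i`. -/
noncomputable def sides (R : M.Region) : ℕ := {d | M.leftRegion d = R}.ncard

/-- The Euler characteristic of the underlying surface. -/
noncomputable def eulerChar : ℤ :=
  (Nat.card M.Vertex : ℤ) - Nat.card M.Edge + Nat.card M.Region

/-- The (open) cells of the subdivision. -/
inductive Cell
  | vertex (v : M.Vertex)
  | edge (e : M.Edge)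
  | region (R : M.Region)

/-- The closure of a vertex, as the set of the open cells that it consists of. -/
def closedVertex (v : M.Vertex) : Set M.Cell := {Cell.vertex v}

/-- The closure of an edge: the edge and its end points. -/
def closedEdge (e : M.Edge) : Set M.Cell :=
  {Cell.edge e} ∪ {c | ∃ d, M.edgeOf d = e ∧ c = Cell.vertex (M.origin d)}

/-- The closure of a region: the region and the closed edges on its boundary curve. -/
def closedRegion (R : M.Region) : Set M.Cell :=
  {Cell.region R} ∪ {c | ∃ d, M.leftRegion d = R ∧ c ∈ M.closedEdge (M.edgeOf d)}

end CellMap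

/-- A (non-trivial) planar doodle diagram: a connected 4-valent graph on the sphere, given by
the cell subdivision of the sphere that it defines. The sphere is the closed connected
oriented surface of Euler characteristic 2. -/
structure PlanarDoodle (D : Type*) extends CellMap D where
  four_valent : ∀ v, toCellMap.valency v = 4
  connected : toCellMap.graph.Connected
  spherical : toCellMap.eulerChar = 2

namespace PlanarDoodle

variable {D : Type*} (M : PlanarDoodle D)

/-- A diagram is minimal if no region is a monogon or a bigon. -/
def IsMinimal : Prop := ∀ R : M.Region, M.sides R ≠ 1 ∧ M.sides R ≠ 2

/-- A diagram is 2-connected if its graph is. -/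
def IsTwoConnected : Prop := IsKConnected M.graph 2

/-- A diagram is prime if its graph is 3-connected. -/
def IsPrime : Prop := IsKConnected M.graph 3

end PlanarDoodle

open scoped Classical

/-! The topological input is a discrete Jordan curve theorem. A closed curve that meets the diagram
only at crossings, passing there from corner to corner, has two sides. On the sphere these are given
by a function on edges modulo 2 that changes, as one turns around a crossing, exactly at the corners
the curve uses (`exists_sides`). It exists because the first cohomology modulo 2 vanishes, which
follows from Euler characteristic 2 by counting ranks (`exists_coboundary`).

With one crossing on the curve, 2-connectivity and minimality show that a region has at most one
corner at each crossing (`eq_of_origin_of_leftRegion`). Hence there are no loops, and consecutive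
darts at a crossing have different ends.

If D is prime and two regions share crossings u and v, take the curve through both regions and both
crossings. Removing u and v leaves the graph connected, so one side of the curve contains only edges
joining u to v. No two of these are consecutive at u, so each of them separates the two regions, and
the intersection of the closures can contain nothing beyond one closed edge.

Conversely, let u, v separate the graph into A and B. The edges touching B form runs around u. The
two corners bounding the run of other edges around an edge to A lie in distinct regions, and by
parity both regions also reach v. The hypothesis then gives an edge uv that has to fill the whole
run, though the run contains an edge to A. -/

theorem sameCycle_iff_of_apply_apply_eq_self {α : Type*} {σ : Equiv.Perm α} {x y : α}
    (hx : σ (σ x) = x) : σ.SameCycle x y ↔ y = x ∨ y = σ x := by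
  constructor
  · rintro ⟨i, rfl⟩
    exact Equiv.Perm.zpow_apply_eq_of_apply_apply_eq_self hx i
  · rintro (rfl | rfl)
    · exact Equiv.Perm.SameCycle.refl _ _
    · exact Equiv.Perm.sameCycle_apply_right.2 (Equiv.Perm.SameCycle.refl _ _)

/-! ### Combinatorial maps: darts, corners and connectivity -/

namespace CellMap

variable {D : Type*} (M : CellMap D)

theorem origin_eq_iff {d d' : D} : M.origin d = M.origin d' ↔ M.next.SameCycle d d' :=
  Quotient.eq (r := Equiv.Perm.SameCycle.setoid M.next)

theorem leftRegion_eq_iff {d d' : D} :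
    M.leftRegion d = M.leftRegion d' ↔ M.walk.SameCycle d d' :=
  Quotient.eq (r := Equiv.Perm.SameCycle.setoid M.walk)

theorem origin_surjective : Function.Surjective M.origin := Quotient.mk_surjective

theorem edgeOf_surjective : Function.Surjective M.edgeOf := Quotient.mk_surjective

theorem leftRegion_surjective : Function.Surjective M.leftRegion := Quotient.mk_surjective

instance [Finite D] : Finite M.Vertex := Finite.of_surjective _ M.origin_surjective

instance [Finite D] : Finite M.Edge := Finite.of_surjective _ M.edgeOf_surjective

instance [Finite D] : Finite M.Region := Finite.of_surjective _ M.leftRegion_surjective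

@[simp]
theorem origin_next (d : D) : M.origin (M.next d) = M.origin d :=
  M.origin_eq_iff.2 (Equiv.Perm.sameCycle_apply_left.2 (Equiv.Perm.SameCycle.refl _ _))

@[simp]
theorem origin_next_symm (d : D) : M.origin (M.next.symm d) = M.origin d := by
  rw [← M.origin_next (M.next.symm d), Equiv.apply_symm_apply]

@[simp]
theorem leftRegion_walk (d : D) : M.leftRegion (M.walk d) = M.leftRegion d :=
  M.leftRegion_eq_iff.2 (Equiv.Perm.sameCycle_apply_left.2 (Equiv.Perm.SameCycle.refl _ _))

theorem walk_apply (d : D) : M.walk d = M.next.symm (M.rev d) := rfl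

@[simp]
theorem next_walk (d : D) : M.next (M.walk d) = M.rev d := by simp [walk_apply]

@[simp]
theorem walk_rev_next (d : D) : M.walk (M.rev (M.next d)) = d := by
  simp [walk_apply, M.rev_rev]

@[simp]
theorem walk_rev (d : D) : M.walk (M.rev d) = M.next.symm d := by
  simp [walk_apply, M.rev_rev]

@[simp]
theorem origin_walk (d : D) : M.origin (M.walk d) = M.origin (M.rev d) := by
  simp [walk_apply]

@[simp]
theorem leftRegion_rev_next (d : D) : M.leftRegion (M.rev (M.next d)) = M.leftRegion d := by
  rw [← M.leftRegion_walk, M.walk_rev_next]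

theorem edgeOf_eq_iff {d d' : D} : M.edgeOf d = M.edgeOf d' ↔ d' = d ∨ d' = M.rev d :=
  (Quotient.eq (r := Equiv.Perm.SameCycle.setoid M.rev)).trans
    (sameCycle_iff_of_apply_apply_eq_self (M.rev_rev d))

@[simp]
theorem edgeOf_rev (d : D) : M.edgeOf (M.rev d) = M.edgeOf d :=
  M.edgeOf_eq_iff.2 (Or.inr (M.rev_rev d).symm)

/-- Turning around a crossing of `s` reaches all its darts, and reversal passes to the neighbouring
crossing, so the value of `φ` is carried along any path in `s`. Edges with one end outside `s` do no
harm, since `φ` need not be preserved by turning there. -/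
theorem eq_of_invariant {α : Type*} {s : Set M.Vertex} (hs : (M.graph.induce s).Preconnected)
    (φ : D → α) (hrev : ∀ d, φ (M.rev d) = φ d)
    (hnext : ∀ d, M.origin d ∈ s → φ (M.next d) = φ d) {d d' : D} (hd : M.origin d ∈ s)
    (hd' : M.origin d' ∈ s) : φ d = φ d' := by
  have hpow : ∀ (n : ℕ) (d : D), M.origin d ∈ s →
      φ ((M.next ^ n) d) = φ d ∧ M.origin ((M.next ^ n) d) = M.origin d := by
    intro n
    induction n with
    | zero => simp
    | succ n ih =>
      intro d hd
      have := ih d hd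
      rw [pow_succ', Equiv.Perm.mul_apply, hnext _ (this.2 ▸ hd), M.origin_next]
      exact this
  have hcyc : ∀ d d' : D, M.origin d ∈ s → M.origin d = M.origin d' → φ d = φ d' := by
    intro d d' hd h
    obtain ⟨i, hi⟩ := M.origin_eq_iff.1 h
    obtain ⟨n, rfl | rfl⟩ := i.eq_nat_or_neg
    · rw [← hi]; exact ((hpow n d hd).1).symm
    · have : d = (M.next ^ n) d' := by
        rw [← hi]; simp
      rw [this]; exact (hpow n d' (h ▸ hd)).1
  suffices H : ∀ (a b : s), (M.graph.induce s).Reachable a b → ∀ d d', M.origin d = a →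
      M.origin d' = b → φ d = φ d' from H ⟨_, hd⟩ ⟨_, hd'⟩ (hs _ _) d d' rfl rfl
  rintro a b ⟨w⟩
  induction w with
  | nil => intro d d' h h'; exact hcyc d d' (h ▸ Subtype.property _) (h.trans h'.symm)
  | cons hadj _ ih =>
    intro d d' h h'
    obtain ⟨-, e, he, he'⟩ := hadj
    rw [← ih (M.rev e) d' he' h', hrev]
    exact hcyc d e (h ▸ Subtype.property _) (h.trans he.symm)

theorem eq_of_invariant_of_connected {α : Type*} (hM : M.graph.Connected) (φ : D → α)
    (hrev : ∀ d, φ (M.rev d) = φ d) (hnext : ∀ d, φ (M.next d) = φ d) (d d' : D) :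
    φ d = φ d' := by
  refine M.eq_of_invariant (s := Set.univ) ?_ φ hrev (fun d _ => hnext d) trivial trivial
  exact ((SimpleGraph.induceUnivIso M.graph).connected_iff.2 hM).preconnected

/-! ### Cohomology modulo 2 of the sphere and separating curves -/

section Exactness

variable [Fintype D]

/-- The matrix of the incidence relation that the darts set up between the images
of `p` and of `q`. -/
noncomputable def incidence {A B : Type*} (p : D → A) (q : D → B) :
    Matrix B A (ZMod 2) :=
  fun b a => ∑ d with q d = b, if p d = a then 1 else 0

theorem incidence_mulVec {A B : Type*} [Fintype A] (p : D → A) (q : D → B) (g : A → ZMod 2)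
    (b : B) : (incidence p q).mulVec g b = ∑ d with q d = b, g (p d) := by
  simp only [Matrix.mulVec, dotProduct, incidence, Finset.sum_mul]
  rw [Finset.sum_comm]
  simp

theorem incidence_transpose {A B : Type*} (p : D → A) (q : D → B) :
    (incidence p q).transpose = incidence q p := by
  ext a b
  simp only [Matrix.transpose_apply, incidence, Finset.sum_filter]
  refine Finset.sum_congr rfl fun d _ => ?_
  split_ifs <;> rfl

theorem sum_edgeOf (φ : D → ZMod 2) (d : D) :
    ∑ x with M.edgeOf x = M.edgeOf d, φ x = φ d + φ (M.rev d) := by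
  have : (Finset.univ.filter fun x => M.edgeOf x = M.edgeOf d) = {d, M.rev d} := by
    ext x
    rw [Finset.mem_filter_univ, Finset.mem_insert, Finset.mem_singleton,
      eq_comm, M.edgeOf_eq_iff]
  rw [this, Finset.sum_pair (M.rev_ne d).symm]

theorem sum_leftRegion_walk (φ : D → ZMod 2) (T : M.Region) :
    ∑ x with M.leftRegion x = T, φ (M.walk x) = ∑ x with M.leftRegion x = T, φ x := by
  simp only [Finset.sum_filter]
  rw [← Equiv.sum_comp M.walk fun x => if M.leftRegion x = T then φ x else 0]
  simp

/-- If `x` is a side of `T`, the corner at its end lies between `M.walk x` and `M.next (M.walk x) =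
M.rev x`. This turns sums over sides into sums over corners. -/
theorem sum_leftRegion_rev (φ : D → ZMod 2) (T : M.Region) :
    ∑ x with M.leftRegion x = T, φ (M.rev x) = ∑ x with M.leftRegion x = T, φ (M.next x) := by
  rw [← M.sum_leftRegion_walk fun x => φ (M.next x)]
  simp

/-- The kernel consists of the functions that agree at `p d` and `p (M.rev d)` for every dart. It
serves for crossings (`p = M.origin`) and, dually, for regions (`p = M.leftRegion`). -/
theorem finrank_ker_le_one {A : Type*} [Fintype A] (p : D → A)
    (hM : ∀ g : A → ZMod 2, (∀ d, g (p d) = g (p (M.rev d))) → ∀ a b, g a = g b)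
    [Fintype M.Edge] :
    Module.finrank (ZMod 2) (LinearMap.ker (incidence p M.edgeOf).mulVecLin) ≤ 1 := by
  have hker : ∀ g, g ∈ LinearMap.ker (incidence p M.edgeOf).mulVecLin ↔
      ∀ d, g (p d) = g (p (M.rev d)) := by
    intro g
    rw [LinearMap.mem_ker, funext_iff, M.edgeOf_surjective.forall]
    refine forall_congr' fun d => ?_
    rw [Matrix.mulVecLin_apply, incidence_mulVec, M.sum_edgeOf (fun x => g (p x))]
    exact CharTwo.add_eq_zero
  refine finrank_le_one ⟨fun _ => 1, (hker _).2 fun _ => rfl⟩ ?_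
  rintro ⟨g, hg⟩
  by_cases hA : Nonempty A
  · obtain ⟨a⟩ := hA
    refine ⟨g a, Subtype.ext (funext fun b => ?_)⟩
    simpa using hM g ((hker g).1 hg) a b
  · exact ⟨0, Subtype.ext (funext fun b => (hA ⟨b⟩).elim)⟩

/-- On the sphere, every cocycle modulo 2 is a coboundary. -/
theorem exists_coboundary (hM : M.graph.Connected) (hE : M.eulerChar = 2)
    (f : M.Edge → ZMod 2) (hf : ∀ T, ∑ d with M.leftRegion d = T, f (M.edgeOf d) = 0) :
    ∃ g : M.Vertex → ZMod 2, ∀ d, f (M.edgeOf d) = g (M.origin d) + g (M.origin (M.rev d)) := by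
  have := Fintype.ofFinite M.Vertex
  have := Fintype.ofFinite M.Edge
  have := Fintype.ofFinite M.Region
  set δ₀ := (incidence M.origin M.edgeOf).mulVecLin with hδ₀
  set δ₁ := (incidence M.edgeOf M.leftRegion).mulVecLin with hδ₁
  have h0 : Module.finrank (ZMod 2) (LinearMap.ker δ₀) ≤ 1 := by
    refine M.finrank_ker_le_one _ fun g hg => ?_
    have := M.eq_of_invariant_of_connected hM (fun d => g (M.origin d)) (fun d => (hg d).symm)
      (fun d => by simp)
    rw [M.origin_surjective.forall₂]
    exact this
  have h1 : Module.finrank (ZMod 2)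
      (LinearMap.ker (incidence M.leftRegion M.edgeOf).mulVecLin) ≤ 1 := by
    refine M.finrank_ker_le_one _ fun g hg => ?_
    have := M.eq_of_invariant_of_connected hM (fun d => g (M.leftRegion d))
      (fun d => (hg d).symm)
      (fun d => by rw [hg (M.next d), M.leftRegion_rev_next])
    rw [M.leftRegion_surjective.forall₂]
    exact this
  have r0 := LinearMap.finrank_range_add_finrank_ker δ₀
  have r1 := LinearMap.finrank_range_add_finrank_ker δ₁
  have r2 := LinearMap.finrank_range_add_finrank_ker
    (incidence M.leftRegion M.edgeOf).mulVecLin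
  have hrk : Module.finrank (ZMod 2) (LinearMap.range δ₁) = Module.finrank (ZMod 2)
      (LinearMap.range (incidence M.leftRegion M.edgeOf).mulVecLin) := by
    have := Matrix.rank_transpose (incidence M.leftRegion M.edgeOf)
    rwa [incidence_transpose] at this
  simp only [Module.finrank_fintype_fun_eq_card] at r0 r1 r2
  rw [eulerChar] at hE
  simp only [Nat.card_eq_fintype_card] at hE
  have hle : LinearMap.range δ₀ ≤ LinearMap.ker δ₁ := by
    rintro _ ⟨g, rfl⟩
    rw [LinearMap.mem_ker]
    ext T
    rw [hδ₁, Matrix.mulVecLin_apply, incidence_mulVec]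
    simp only [hδ₀, Matrix.mulVecLin_apply, incidence_mulVec,
      M.sum_edgeOf (fun x => g (M.origin x)), Finset.sum_add_distrib]
    rw [M.sum_leftRegion_rev fun x => g (M.origin x)]
    simp only [origin_next]
    exact CharTwo.add_self_eq_zero _
  -- Write V, E, F for the numbers of cells. The rank of `δ₁` is that of its transpose, at least F -
  -- 1, so its kernel has dimension at most E - F + 1 = V - 1, which the rank of `δ₀` attains.
  have heq := Submodule.eq_of_le_of_finrank_le hle (by omega)
  have : f ∈ LinearMap.ker δ₁ := by
    rw [LinearMap.mem_ker]
    ext T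
    rw [hδ₁, Matrix.mulVecLin_apply, incidence_mulVec, hf]
    rfl
  rw [← heq] at this
  obtain ⟨g, rfl⟩ := this
  refine ⟨g, fun d => ?_⟩
  rw [hδ₀, Matrix.mulVecLin_apply, incidence_mulVec, M.sum_edgeOf fun x => g (M.origin x)]

/-- The indicator function of a dart. -/
noncomputable def mark (a : D) : D → ZMod 2 := fun d => if d = a then 1 else 0

/-- `mark a` stands for the corner between `a` and `M.next a`. `I` counts modulo 2 the darts passed
in turning from the corner of `d₁` to that of `d₂`, and the sum telescopes. -/
theorem exists_interval {d₁ d₂ : D} (h : M.origin d₁ = M.origin d₂) :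
    ∃ I : D → ZMod 2, ∀ d, I d + I (M.next d) = mark d₁ d + mark d₂ d := by
  obtain ⟨k, rfl⟩ := (M.origin_eq_iff.1 h).exists_nat_pow_eq
  clear h
  induction k with
  | zero => exact ⟨0, fun d => by simp [CharTwo.add_self_eq_zero]⟩
  | succ k ih =>
    obtain ⟨I, hI⟩ := ih
    refine ⟨I + mark ((M.next ^ (k + 1)) d₁), fun d => ?_⟩
    have : mark ((M.next ^ (k + 1)) d₁) (M.next d) =
        mark ((M.next ^ k) d₁) d := by
      simp [mark, pow_succ']
    simp only [Pi.add_apply, this]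
    linear_combination hI d + CharTwo.add_self_eq_zero
      (mark ((M.next ^ k) d₁) d)

/-- The two sides of a closed curve that crosses the diagram only at two of its vertices,
passing there from the corner of `d₁` to that of `d₂` and from the corner of `d₄` to that of
`d₃`. -/
theorem exists_sides (hM : M.graph.Connected) (hE : M.eulerChar = 2) {d₁ d₂ d₃ d₄ : D}
    (h12 : M.origin d₁ = M.origin d₂) (h34 : M.origin d₃ = M.origin d₄)
    (h13 : M.leftRegion d₁ = M.leftRegion d₃) (h24 : M.leftRegion d₂ = M.leftRegion d₄) :
    ∃ h : D → ZMod 2, (∀ d, h (M.rev d) = h d) ∧ ∀ d, h d + h (M.next d) =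
      mark d₁ d + mark d₂ d + (mark d₃ d + mark d₄ d) := by
  obtain ⟨I, hI⟩ := M.exists_interval h12
  obtain ⟨J, hJ⟩ := M.exists_interval h34
  -- `I + J` has the right jumps but may differ on the two darts of an edge. That discrepancy is a
  -- cocycle, because the marked corners of each region come in pairs, and adding a potential `g` on
  -- crossings removes it without affecting the jumps.
  obtain ⟨g, hg⟩ := M.exists_coboundary hM hE
    (fun e => ∑ d with M.edgeOf d = e, (I d + J d)) (fun T => by
      simp only [M.sum_edgeOf fun d => I d + J d]
      rw [Finset.sum_add_distrib, M.sum_leftRegion_rev fun d => I d + J d,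
        ← Finset.sum_add_distrib]
      have : ∀ d, I d + J d + (I (M.next d) + J (M.next d)) = mark d₁ d +
          mark d₂ d + (mark d₃ d + mark d₄ d) := fun d => by
        rw [← hI, ← hJ]; ring
      simp only [this, Finset.sum_add_distrib, mark]
      simp only [Finset.sum_ite_eq', Finset.mem_filter, Finset.mem_univ, true_and, h13, h24]
      generalize (if M.leftRegion d₃ = T then (1 : ZMod 2) else 0) = a
      generalize (if M.leftRegion d₄ = T then (1 : ZMod 2) else 0) = b
      exact CharTwo.add_self_eq_zero _)
  refine ⟨fun d => I d + J d + g (M.origin d), fun d => ?_, fun d => ?_⟩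
  · have := hg d
    simp only [M.sum_edgeOf fun d => I d + J d] at this
    have h2 := CharTwo.add_self_eq_zero (I d + J d)
    have h3 := CharTwo.add_self_eq_zero (g (M.origin (M.rev d)))
    linear_combination this - h2 + h3
  · simp only [origin_next]
    linear_combination hI d + hJ d + CharTwo.add_self_eq_zero (g (M.origin d))

end Exactness

end CellMap

theorem ZMod.eq_or_eq_of_ne_two {a b : ZMod 2} (h : a ≠ b) (z : ZMod 2) :
    a ≠ z ∧ b = z ∨ a = z ∧ b ≠ z := by
  revert a b z
  decide

theorem Finset.even_card_of_involutive {α : Type*} (s : Finset α) (σ : α → α)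
    (hσ : ∀ a, σ (σ a) = a) (hne : ∀ a, σ a ≠ a) (hs : ∀ a ∈ s, σ a ∈ s) : Even s.card := by
  have : ∑ _a ∈ s, (1 : ZMod 2) = 0 :=
    Finset.sum_involution (fun a _ => σ a) (fun _ _ => by decide) (fun a _ _ => hne a)
      (fun a ha => hs a ha) (fun a _ => hσ a)
  rw [Finset.sum_const, nsmul_one] at this
  exact even_iff_two_dvd.2 ((ZMod.natCast_eq_zero_iff _ _).1 this)

/-! ### Closures of cells -/

namespace CellMap

variable {D : Type*} (M : CellMap D)

theorem vertex_mem_closedRegion {v : M.Vertex} {R : M.Region} :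
    Cell.vertex v ∈ M.closedRegion R ↔ ∃ d, M.leftRegion d = R ∧ M.origin d = v := by
  constructor
  · rintro (h | ⟨d, rfl, h | ⟨d', hd', h⟩⟩)
    · cases h
    · cases h
    · cases h
      rw [eq_comm, M.edgeOf_eq_iff] at hd'
      obtain rfl | rfl := hd'
      · exact ⟨_, rfl, rfl⟩
      · exact ⟨M.walk d, by simp⟩
  · rintro ⟨d, rfl, rfl⟩
    exact Or.inr ⟨d, rfl, Or.inr ⟨d, rfl, rfl⟩⟩

theorem edge_mem_closedRegion {e : M.Edge} {R : M.Region} :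
    Cell.edge e ∈ M.closedRegion R ↔ ∃ d, M.leftRegion d = R ∧ M.edgeOf d = e := by
  constructor
  · rintro (h | ⟨d, rfl, h | ⟨d', hd', h⟩⟩)
    · cases h
    · cases h
      exact ⟨_, rfl, rfl⟩
    · cases h
  · rintro ⟨d, rfl, rfl⟩
    exact Or.inr ⟨d, rfl, Or.inl rfl⟩

theorem region_mem_closedRegion {R S : M.Region} :
    Cell.region S ∈ M.closedRegion R ↔ S = R := by
  constructor
  · rintro (h | ⟨d, rfl, h | ⟨d', hd', h⟩⟩)
    · cases h; rfl
    · cases h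
    · cases h
  · rintro rfl
    exact Or.inl rfl

theorem vertex_mem_closedEdge {v : M.Vertex} {d : D} :
    Cell.vertex v ∈ M.closedEdge (M.edgeOf d) ↔ v = M.origin d ∨ v = M.origin (M.rev d) := by
  constructor
  · rintro (h | ⟨d', hd', h⟩)
    · cases h
    · cases h
      rw [eq_comm, M.edgeOf_eq_iff] at hd'
      obtain rfl | rfl := hd' <;> simp
  · rintro (rfl | rfl)
    · exact Or.inr ⟨d, rfl, rfl⟩
    · exact Or.inr ⟨M.rev d, by simp, rfl⟩

theorem edge_mem_closedEdge {e e' : M.Edge} : Cell.edge e ∈ M.closedEdge e' ↔ e = e' := by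
  constructor
  · rintro (h | ⟨d', hd', h⟩)
    · cases h; rfl
    · cases h
  · rintro rfl
    exact Or.inl rfl

theorem region_notMem_closedEdge {R : M.Region} {e : M.Edge} :
    Cell.region R ∉ M.closedEdge e := by
  rintro (h | ⟨d', hd', h⟩) <;> cases h

theorem exists_forall_eq_of_connected {α : Type*} {s : Set M.Vertex}
    (hs : (M.graph.induce s).Connected) (φ : D → α) (hrev : ∀ d, φ (M.rev d) = φ d)
    (hnext : ∀ d, M.origin d ∈ s → φ (M.next d) = φ d) :
    ∃ z, ∀ d, M.origin d ∈ s → φ d = z := by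
  obtain ⟨⟨v, hv⟩⟩ := hs.nonempty
  obtain ⟨d, rfl⟩ := M.origin_surjective v
  exact ⟨φ d, fun d' hd' => M.eq_of_invariant hs.preconnected φ hrev hnext hd' hv⟩

end CellMap

/-! ### Minimal 2-connected diagrams, and shared crossings in prime ones -/

namespace PlanarDoodle

variable {D : Type*} {M : PlanarDoodle D}

theorem next_next_ne (d : D) : M.next (M.next d) ≠ d := by
  intro h
  have hv := M.four_valent (M.origin d)
  have : {x | M.origin x = M.origin d} ⊆ {d, M.next d} := fun x hx =>
    (sameCycle_iff_of_apply_apply_eq_self h).1 (M.origin_eq_iff.1 (Eq.symm hx))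
  have h1 := Set.ncard_le_ncard this (Set.toFinite _)
  have h2 := Set.ncard_insert_le d {M.next d}
  rw [Set.ncard_singleton] at h2
  rw [CellMap.valency] at hv
  omega

theorem next_ne (d : D) : M.next d ≠ d := fun h => M.next_next_ne d (by rw [h, h])

theorem IsMinimal.walk_walk_ne (hmin : M.IsMinimal) (d : D) : M.walk (M.walk d) ≠ d := by
  intro h
  have : {x | M.leftRegion x = M.leftRegion d} = {d, M.walk d} := by
    ext x
    exact (eq_comm.trans M.leftRegion_eq_iff).trans (sameCycle_iff_of_apply_apply_eq_self h)
  have hs := hmin (M.leftRegion d)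
  rw [CellMap.sides, this] at hs
  by_cases hw : M.walk d = d
  · rw [hw] at hs
    simp at hs
  · rw [Set.ncard_pair (Ne.symm hw)] at hs
    simp at hs

theorem IsMinimal.walk_ne (hmin : M.IsMinimal) (d : D) : M.walk d ≠ d := fun h =>
  hmin.walk_walk_ne d (by rw [h, h])

/-- A region has at most one corner at each vertex. -/
theorem eq_of_origin_of_leftRegion [Finite D] (hmin : M.IsMinimal) (h2 : M.IsTwoConnected)
    {d₁ d₂ : D} (ho : M.origin d₁ = M.origin d₂) (hl : M.leftRegion d₁ = M.leftRegion d₂) :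
    d₁ = d₂ := by
  by_contra hne
  have := Fintype.ofFinite D
  -- Here `d₃ = d₄ = d₁`: the second passage is trivial and its marks cancel, leaving a curve
  -- through a single crossing.
  obtain ⟨h, hrev, hh⟩ := M.exists_sides M.connected M.spherical ho (rfl : M.origin d₁ = _)
    (rfl : M.leftRegion d₁ = _) hl.symm
  have hch : ∀ d, h d ≠ h (M.next d) ↔ d = d₁ ∨ d = d₂ := by
    intro d
    rw [ne_eq, ← CharTwo.add_eq_zero, hh]
    simp only [CellMap.mark]
    by_cases e1 : d = d₁
    · subst e1; simp [hne]; decide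
    · by_cases e2 : d = d₂
      · subst e2; simp [e1]
      · simp [e1, e2]
  obtain ⟨z, hz⟩ := M.exists_forall_eq_of_connected (h2.2 {M.origin d₁} (by simp)) h hrev
    (fun d hd => by
      by_contra hc
      obtain rfl | rfl := (hch d).1 (Ne.symm hc)
      · simp at hd
      · simp [ho] at hd)
  have hz' : ∀ d, h d ≠ z → M.origin d = M.origin d₁ := fun d hd => by
    by_contra hc
    exact hd (hz d (by simpa using hc))
  -- `L` is one side of the curve. Its darts are loops at the crossing, so their number is even; it
  -- is positive and less than 4, hence `L` is a single loop.
  set L : Finset D := Finset.univ.filter fun d => h d ≠ z with hL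
  have hmem : ∀ d, d ∈ L ↔ h d ≠ z := fun d => by simp [hL]
  have heven : Even L.card := L.even_card_of_involutive M.rev M.rev_rev M.rev_ne
    fun d hd => by rw [hmem] at hd ⊢; rwa [hrev]
  have hlt : L.card < 4 := by
    rw [← M.four_valent (M.origin d₁), CellMap.valency, ← Set.ncard_coe_finset]
    refine Set.ncard_lt_ncard ⟨fun d hd => hz' d ((hmem d).1 hd), fun hsub => ?_⟩ (Set.toFinite _)
    have h1 := (hmem _).1 (hsub (rfl : M.origin d₁ = _))
    have h2 := (hmem _).1 (hsub (M.origin_next d₁ : M.origin (M.next d₁) = _))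
    obtain h | h := ZMod.eq_or_eq_of_ne_two ((hch d₁).2 (Or.inl rfl)) z
    · exact h2 h.2
    · exact h1 h.1
  have hpos : 0 < L.card := by
    rw [Finset.card_pos]
    obtain h | h := ZMod.eq_or_eq_of_ne_two ((hch d₁).2 (Or.inl rfl)) z
    · exact ⟨_, (hmem _).2 h.1⟩
    · exact ⟨_, (hmem _).2 h.2⟩
  obtain ⟨x, hx⟩ := Finset.card_pos.1 hpos
  have hLx : L = {x, M.rev x} := by
    symm
    refine Finset.eq_of_subset_of_card_le ?_ ?_
    · rw [Finset.insert_subset_iff, Finset.singleton_subset_iff]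
      refine ⟨hx, ?_⟩
      rw [hmem] at hx ⊢
      rwa [hrev]
    · rw [Finset.card_pair (M.rev_ne x).symm]
      obtain ⟨k, hk⟩ := heven
      omega
  have hmem' : ∀ d, h d ≠ z ↔ d = x ∨ d = M.rev x := fun d => by
    rw [← hmem, hLx, Finset.mem_insert, Finset.mem_singleton]
  by_cases n1 : M.next x = M.rev x
  · exact hmin.walk_ne x (by rw [CellMap.walk_apply, ← n1, Equiv.symm_apply_apply])
  by_cases n2 : M.next (M.rev x) = x
  · exact hmin.walk_ne (M.rev x) (by
      rw [CellMap.walk_rev, Equiv.symm_apply_eq, n2])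
  have hx' := (hmem' x).2 (Or.inl rfl)
  have hr' := (hmem' (M.rev x)).2 (Or.inr rfl)
  have c1 : h (M.next x) = z := by
    by_contra hc
    exact ((hmem' _).1 hc).elim (M.next_ne x) n1
  have c2 : h (M.next (M.rev x)) = z := by
    by_contra hc
    exact ((hmem' _).1 hc).elim n2 (M.next_ne _)
  have c3 : h (M.next.symm x) = z := by
    by_contra hc
    obtain hc | hc := (hmem' _).1 hc
    · exact M.next_ne x (Equiv.symm_apply_eq _ |>.1 hc).symm
    · exact n2 (Equiv.symm_apply_eq _ |>.1 hc).symm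
  -- The two ends of the loop are not adjacent around the crossing, so `h` jumps at three different
  -- corners, but only two are marked.
  have e1 := (hch x).1 (by rwa [c1])
  have e2 := (hch (M.rev x)).1 (by rwa [c2])
  have e3 := (hch (M.next.symm x)).1 (by rw [c3, Equiv.apply_symm_apply]; exact hx'.symm)
  have hsx : M.next.symm x ≠ x := fun hc => hx' (hc ▸ c3)
  have hsr : M.next.symm x ≠ M.rev x := fun hc => hr' (hc ▸ c3)
  have hrx := M.rev_ne x
  grind

variable [Finite D]

theorem origin_rev_ne (hmin : M.IsMinimal) (h2 : M.IsTwoConnected) (d : D) :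
    M.origin (M.rev d) ≠ M.origin d := fun h =>
  hmin.walk_ne d (eq_of_origin_of_leftRegion hmin h2 (by rw [CellMap.origin_walk, h]) (by simp))

theorem origin_rev_next_ne (hmin : M.IsMinimal) (h2 : M.IsTwoConnected) (d : D) :
    M.origin (M.rev (M.next d)) ≠ M.origin (M.rev d) := fun h => by
  have := eq_of_origin_of_leftRegion hmin h2 (d₁ := M.walk d) (d₂ := M.rev (M.next d))
    (by rw [CellMap.origin_walk, h]) (by simp)
  exact hmin.walk_walk_ne d (by rw [this, CellMap.walk_rev_next])

/-- Two consecutive darts do not separate the same two regions. -/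
theorem origin_ne_origin_rev (hmin : M.IsMinimal) (h2 : M.IsTwoConnected) {x y : D}
    (hl : M.leftRegion x = M.leftRegion y)
    (hr : M.leftRegion (M.rev x) = M.leftRegion (M.rev y)) :
    M.origin x ≠ M.origin (M.rev y) := fun h => by
  have h1 : M.walk y = x := eq_of_origin_of_leftRegion hmin h2 (by simp [h]) (by simp [hl])
  have h3 : M.walk (M.rev x) = M.rev y :=
    eq_of_origin_of_leftRegion hmin h2 (by simp [h]) (by rw [CellMap.leftRegion_walk, hr])
  have h4 : M.next x = M.rev y := by rw [← h1, CellMap.next_walk]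
  rw [CellMap.walk_rev, Equiv.symm_apply_eq] at h3
  exact M.next_next_ne x (by rw [h4, ← h3])

theorem eq_of_same_regions (hmin : M.IsMinimal) (h2 : M.IsTwoConnected) {x y : D}
    (hl : M.leftRegion x = M.leftRegion y)
    (hr : M.leftRegion (M.rev x) = M.leftRegion (M.rev y)) {v : M.Vertex}
    (hx : v = M.origin x ∨ v = M.origin (M.rev x))
    (hy : v = M.origin y ∨ v = M.origin (M.rev y)) : x = y := by
  obtain rfl | rfl := hx <;> obtain hy | hy := hy
  · exact eq_of_origin_of_leftRegion hmin h2 hy hl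
  · exact (origin_ne_origin_rev hmin h2 hl hr hy).elim
  · exact (origin_ne_origin_rev hmin h2 hl.symm hr.symm hy.symm).elim
  · exact M.rev.injective (eq_of_origin_of_leftRegion hmin h2 hy hr)

/-- In a prime diagram, two regions that share two crossings share an edge between them. -/
theorem IsPrime.exists_common_edge (hmin : M.IsMinimal) (h2 : M.IsTwoConnected)
    (h3 : M.IsPrime) {R S : M.Region} (hRS : R ≠ S) {u v : M.Vertex} (huv : u ≠ v)
    (huR : CellMap.Cell.vertex u ∈ M.closedRegion R)
    (huS : CellMap.Cell.vertex u ∈ M.closedRegion S)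
    (hvR : CellMap.Cell.vertex v ∈ M.closedRegion R)
    (hvS : CellMap.Cell.vertex v ∈ M.closedRegion S) :
    ∃ x, M.leftRegion x = R ∧ M.leftRegion (M.rev x) = S ∧
      (u = M.origin x ∨ u = M.origin (M.rev x)) ∧
      (v = M.origin x ∨ v = M.origin (M.rev x)) := by
  have := Fintype.ofFinite D
  rw [CellMap.vertex_mem_closedRegion] at huR huS hvR hvS
  obtain ⟨d₁, rfl, rfl⟩ := huR
  obtain ⟨d₂, rfl, h21⟩ := huS
  obtain ⟨d₃, h31, rfl⟩ := hvR
  obtain ⟨d₄, h42, h43⟩ := hvS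
  obtain ⟨h, hrev, hh⟩ := M.exists_sides M.connected M.spherical h21.symm h43.symm h31.symm
    h42.symm
  have n12 : d₁ ≠ d₂ := fun h => hRS (by rw [h])
  have n13 : d₁ ≠ d₃ := fun h => huv (by rw [h])
  have n14 : d₁ ≠ d₄ := fun h => huv (by rw [h, h43])
  have n23 : d₂ ≠ d₃ := fun h => huv (by rw [← h, h21])
  have n24 : d₂ ≠ d₄ := fun h => huv (by rw [← h21, h, h43])
  have n34 : d₃ ≠ d₄ := fun h => hRS (by rw [← h31, h, h42])
  have hch : ∀ d, h d ≠ h (M.next d) ↔ d = d₁ ∨ d = d₂ ∨ d = d₃ ∨ d = d₄ := by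
    intro d
    rw [ne_eq, ← CharTwo.add_eq_zero, hh]
    simp only [CellMap.mark]
    by_cases e1 : d = d₁
    · subst e1; simp [n12, n13, n14]
    by_cases e2 : d = d₂
    · subst e2; simp [n12.symm, n23, n24]
    by_cases e3 : d = d₃
    · subst e3; simp [n13.symm, n23.symm, n34]
    by_cases e4 : d = d₄
    · subst e4; simp [n14.symm, n24.symm, n34.symm]
    simp [e1, e2, e3, e4]
  obtain ⟨z, hz⟩ := M.exists_forall_eq_of_connected
    (h3.2 {M.origin d₁, M.origin d₃} (Finset.card_le_two.trans_lt (by norm_num))) h hrev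
    (fun d hd => by
      by_contra hc
      obtain rfl | rfl | rfl | rfl := (hch d).1 (Ne.symm hc)
      · simp at hd
      · simp [h21] at hd
      · simp at hd
      · simp [h43] at hd)
  have hz' : ∀ d, h d ≠ z → M.origin d = M.origin d₁ ∨ M.origin d = M.origin d₃ := fun d hd => by
    by_contra hc
    exact hd (hz d (by simpa using hc))
  -- On the side of the curve where `h ≠ z`, every edge joins the two crossings, as there are no
  -- loops.
  have hz₁ : ∀ d, h d ≠ z → M.origin d = M.origin d₁ → M.origin (M.rev d) = M.origin d₃ :=
    fun d hd ho => (hz' (M.rev d) (by rwa [hrev])).resolve_left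
      fun hr => origin_rev_ne hmin h2 d (hr.trans ho.symm)
  have hch₁ : ∀ d, h d ≠ h (M.next d) → M.origin d = M.origin d₁ → d = d₁ ∨ d = d₂ := by
    intro d hd ho
    obtain rfl | rfl | rfl | rfl := (hch d).1 hd
    · exact Or.inl rfl
    · exact Or.inr rfl
    · exact (huv ho.symm).elim
    · exact (huv (ho.symm.trans h43)).elim
  obtain ⟨x, hx, hxo⟩ : ∃ x, h x ≠ z ∧ M.origin x = M.origin d₁ := by
    obtain h | h := ZMod.eq_or_eq_of_ne_two ((hch d₁).2 (Or.inl rfl)) z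
    · exact ⟨_, h.1, rfl⟩
    · exact ⟨_, h.2, by simp⟩
  have hxr := hz₁ x hx hxo
  -- Consecutive darts cannot both end at the second crossing, so `h` jumps on either side of `x`.
  -- These two jumps must be the two marked corners, and so `x` separates the two regions.
  have c1 : h (M.next x) = z := by
    by_contra hc
    exact origin_rev_next_ne hmin h2 x ((hz₁ _ hc (by simpa using hxo)).trans hxr.symm)
  have c2 : h (M.next.symm x) = z := by
    by_contra hc
    refine origin_rev_next_ne hmin h2 (M.next.symm x) ?_
    rw [hz₁ _ hc (by simpa using hxo), Equiv.apply_symm_apply, hxr]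
  have e1 := hch₁ x (by rwa [c1]) hxo
  have e2 := hch₁ (M.next.symm x) (by rw [c2, Equiv.apply_symm_apply]; exact hx.symm)
    (by simpa using hxo)
  have hlr : M.leftRegion (M.rev x) = M.leftRegion (M.next.symm x) := by
    rw [← CellMap.walk_rev, CellMap.leftRegion_walk]
  have hne : M.next.symm x ≠ x := fun hc => M.next_ne x (Equiv.symm_apply_eq _ |>.1 hc).symm
  rcases e1 with e1 | e1 <;> rcases e2 with e2 | e2
  · exact (hne (e2.trans e1.symm)).elim
  · exact ⟨x, by rw [e1], by rw [hlr, e2], Or.inl hxo.symm, Or.inr hxr.symm⟩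
  · exact ⟨M.rev x, by rw [hlr, e2], by rw [M.rev_rev, e1], Or.inr (by rw [M.rev_rev, hxo]),
      Or.inl hxr.symm⟩
  · exact (hne (e2.trans e1.symm)).elim

theorem IsPrime.closedRegion_inter (hmin : M.IsMinimal) (h2 : M.IsTwoConnected)
    (h3 : M.IsPrime) {R S : M.Region} (hRS : R ≠ S) :
    M.closedRegion R ∩ M.closedRegion S = ∅ ∨
      (∃ v : M.Vertex, M.closedRegion R ∩ M.closedRegion S = M.closedVertex v) ∨
      (∃ e : M.Edge, M.closedRegion R ∩ M.closedRegion S = M.closedEdge e) := by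
  have hreg : ∀ T, CellMap.Cell.region T ∉ M.closedRegion R ∩ M.closedRegion S := by
    rintro T ⟨hR, hS⟩
    rw [CellMap.region_mem_closedRegion] at hR hS
    exact hRS (hR.symm.trans hS)
  have hedge : ∀ e, CellMap.Cell.edge e ∈ M.closedRegion R ∩ M.closedRegion S →
      ∃ x, M.edgeOf x = e ∧ M.leftRegion x = R ∧ M.leftRegion (M.rev x) = S := by
    rintro e ⟨hR, hS⟩
    rw [CellMap.edge_mem_closedRegion] at hR hS
    obtain ⟨x, rfl, rfl⟩ := hR
    obtain ⟨y, rfl, hy⟩ := hS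
    rw [eq_comm, CellMap.edgeOf_eq_iff] at hy
    obtain rfl | rfl := hy
    · exact (hRS rfl).elim
    · exact ⟨x, rfl, rfl, rfl⟩
  by_cases hE : ∃ e, CellMap.Cell.edge e ∈ M.closedRegion R ∩ M.closedRegion S
  · obtain ⟨e, he⟩ := hE
    obtain ⟨x, rfl, hxR, hxS⟩ := hedge e he
    have hu : CellMap.Cell.vertex (M.origin x) ∈ M.closedRegion R ∩ M.closedRegion S :=
      ⟨M.vertex_mem_closedRegion.2 ⟨x, hxR, rfl⟩,
        M.vertex_mem_closedRegion.2 ⟨M.walk (M.rev x), by rwa [M.leftRegion_walk], by simp⟩⟩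
    have hv : CellMap.Cell.vertex (M.origin (M.rev x)) ∈
        M.closedRegion R ∩ M.closedRegion S :=
      ⟨M.vertex_mem_closedRegion.2 ⟨M.walk x, by simpa using hxR, by simp⟩,
        M.vertex_mem_closedRegion.2 ⟨M.rev x, hxS, rfl⟩⟩
    have hvert : ∀ w, CellMap.Cell.vertex w ∈ M.closedRegion R ∩ M.closedRegion S →
        w = M.origin x ∨ w = M.origin (M.rev x) := by
      intro w hw
      by_contra hc
      push Not at hc
      obtain ⟨y, hyR, hyS, hy1, hy2⟩ := h3.exists_common_edge hmin h2 hRS hc.1.symm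
        hu.1 hu.2 hw.1 hw.2
      obtain rfl := eq_of_same_regions hmin h2 (hxR.trans hyR.symm) (hxS.trans hyS.symm)
        (Or.inl rfl) hy1
      exact hy2.elim hc.1 hc.2
    refine Or.inr (Or.inr ⟨M.edgeOf x, Set.ext fun c => ?_⟩)
    cases c with
    | vertex w =>
      rw [CellMap.vertex_mem_closedEdge]
      refine ⟨hvert w, ?_⟩
      rintro (rfl | rfl)
      · exact hu
      · exact hv
    | edge e' =>
      rw [CellMap.edge_mem_closedEdge]
      refine ⟨fun he' => ?_, fun h => h ▸ he⟩
      obtain ⟨y, rfl, hyR, hyS⟩ := hedge e' he'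
      have hy := hvert (M.origin y) ⟨M.vertex_mem_closedRegion.2 ⟨y, hyR, rfl⟩,
        M.vertex_mem_closedRegion.2 ⟨M.walk (M.rev y), by rwa [M.leftRegion_walk], by simp⟩⟩
      rw [eq_of_same_regions hmin h2 (hxR.trans hyR.symm) (hxS.trans hyS.symm) hy (Or.inl rfl)]
    | region T => exact iff_of_false (hreg T) M.region_notMem_closedEdge
  · by_cases hV : ∃ v, CellMap.Cell.vertex v ∈ M.closedRegion R ∩ M.closedRegion S
    · obtain ⟨v, hv⟩ := hV
      refine Or.inr (Or.inl ⟨v, Set.Subset.antisymm ?_ (Set.singleton_subset_iff.2 hv)⟩)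
      intro c hc
      cases c with
      | vertex w =>
        by_contra hne
        have hvw : v ≠ w := fun h => hne (h ▸ rfl)
        obtain ⟨x, hxR, hxS, -⟩ := h3.exists_common_edge hmin h2 hRS hvw hv.1 hv.2 hc.1 hc.2
        exact hE ⟨M.edgeOf x, M.edge_mem_closedRegion.2 ⟨x, hxR, rfl⟩,
          M.edge_mem_closedRegion.2 ⟨M.rev x, hxS, by simp⟩⟩
      | edge e => exact (hE ⟨e, hc⟩).elim
      | region T => exact (hreg T hc).elim
    · refine Or.inl (Set.eq_empty_of_forall_notMem fun c hc => ?_)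
      cases c with
      | vertex w => exact hV ⟨w, hc⟩
      | edge e => exact hE ⟨e, hc⟩
      | region T => exact hreg T hc

end PlanarDoodle

/-! ### The converse: separating pairs of crossings -/

theorem Equiv.Perm.SameCycle.exists_first {α : Type*} [Finite α] {σ : Equiv.Perm α} {a b : α}
    (h : σ.SameCycle a b) {P : α → Prop} (ha : ¬P a) (hb : P b) :
    ∃ m : ℕ, (∀ i ≤ m, ¬P ((σ ^ i) a)) ∧ P (σ ((σ ^ m) a)) := by
  obtain ⟨k, hk⟩ := h.exists_nat_pow_eq
  have hex : ∃ n : ℕ, P ((σ ^ n) a) := ⟨k, hk ▸ hb⟩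
  obtain ⟨m, hm⟩ : ∃ m, Nat.find hex = m + 1 := Nat.exists_eq_succ_of_ne_zero fun h0 =>
    ha (by simpa [h0] using Nat.find_spec hex)
  refine ⟨m, fun i hi => Nat.find_min hex (by omega), ?_⟩
  have := Nat.find_spec hex
  rwa [hm, pow_succ', Equiv.Perm.mul_apply] at this

theorem SimpleGraph.Preconnected.exists_adj_of_not {V : Type*} {G : SimpleGraph V}
    (hG : G.Preconnected) {P : V → Prop} {a b : V} (ha : P a) (hb : ¬P b) :
    ∃ x y, G.Adj x y ∧ P x ∧ ¬P y := by
  obtain ⟨w⟩ := hG a b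
  obtain ⟨d, -, h1, h2⟩ := w.exists_boundary_dart {x | P x} ha hb
  exact ⟨d.fst, d.snd, d.adj, h1, h2⟩

theorem sum_ncard_fiber {D A : Type*} [Fintype D] [Fintype A] (p : D → A) :
    ∑ a, {d | p d = a}.ncard = Nat.card D := by
  rw [Nat.card_eq_fintype_card, ← Finset.card_univ,
    Finset.card_eq_sum_card_fiberwise (f := p) (t := Finset.univ) (by simp)]
  refine Finset.sum_congr rfl fun a _ => ?_
  rw [← Set.ncard_coe_finset]
  simp

namespace PlanarDoodle

variable {D : Type*} [Finite D] {M : PlanarDoodle D}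

/-- Four-valency gives E = 2V, so F = V + 2 by Euler's formula; without monogons and bigons 3F ≤ 2E
= 4V. -/
theorem IsMinimal.six_le_card_vertex (hmin : M.IsMinimal) : 6 ≤ Nat.card M.Vertex := by
  have := Fintype.ofFinite D
  have := Fintype.ofFinite M.Vertex
  have := Fintype.ofFinite M.Edge
  have := Fintype.ofFinite M.Region
  have hV : ∑ v : M.Vertex, 4 = Nat.card D := by
    rw [← sum_ncard_fiber M.origin]
    exact Finset.sum_congr rfl fun v _ => (M.four_valent v).symm
  have hE : ∑ e : M.Edge, 2 = Nat.card D := by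
    rw [← sum_ncard_fiber M.edgeOf]
    refine Finset.sum_congr rfl fun e _ => ?_
    obtain ⟨d, rfl⟩ := M.edgeOf_surjective e
    rw [← Set.ncard_pair (M.rev_ne d).symm]
    congr 1
    ext x
    exact (M.edgeOf_eq_iff.symm.trans eq_comm)
  have hF : ∑ R : M.Region, 3 ≤ Nat.card D := by
    rw [← sum_ncard_fiber M.leftRegion]
    refine Finset.sum_le_sum fun R _ => ?_
    have h0 : {d | M.leftRegion d = R}.ncard ≠ 0 := by
      obtain ⟨d, rfl⟩ := M.leftRegion_surjective R
      exact Set.ncard_ne_zero_of_mem (a := d) rfl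
    have h12 := hmin R
    rw [CellMap.sides] at h12
    omega
  have hχ := M.spherical
  rw [CellMap.eulerChar] at hχ
  simp only [Finset.sum_const, Finset.card_univ, smul_eq_mul, ← Nat.card_eq_fintype_card]
    at hV hE hF
  omega

/-- If a property of edges changes only at two vertices, a region in whose boundary it changes
at one of them also has a corner at the other. -/
theorem exists_corner_of_change (hmin : M.IsMinimal) (h2 : M.IsTwoConnected) {P : D → Prop}
    (hrev : ∀ d, P (M.rev d) ↔ P d) {v : M.Vertex} {y : D}
    (hnext : ∀ d, M.origin d ≠ M.origin y → M.origin d ≠ v → (P (M.next d) ↔ P d))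
    (hy : ¬(P (M.next y) ↔ P y)) : ∃ d, M.leftRegion d = M.leftRegion y ∧ M.origin d = v := by
  have := Fintype.ofFinite D
  by_contra! hc
  set φ : D → ZMod 2 := fun d => if P d then 1 else 0 with hφ
  -- `P` changes at an even number of corners of a region. The region has only one corner at the
  -- crossing of `y`, so a further change must occur at `v`.
  have hzero : ∑ d with M.leftRegion d = M.leftRegion y, (φ d + φ (M.next d)) = 0 := by
    rw [Finset.sum_add_distrib, ← M.sum_leftRegion_rev]
    simp only [hφ, hrev]
    exact CharTwo.add_self_eq_zero _
  rw [Finset.sum_eq_single y] at hzero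
  · rw [CharTwo.add_eq_zero] at hzero
    by_cases h1 : P y <;> by_cases h2 : P (M.next y) <;> simp [hφ, h1, h2] at hzero hy
  · intro d hd hdy
    rw [Finset.mem_filter_univ] at hd
    have := hnext d (fun ho => hdy (eq_of_origin_of_leftRegion hmin h2 ho hd)) (hc d hd)
    simp only [hφ, this]
    exact CharTwo.add_self_eq_zero _
  · intro h
    simp at h

/-- If an edge on the boundary of a region issues from the vertex of one of the corners of the
region, it is one of the two sides of that corner. -/
theorem eq_or_eq_next_of_edge_mem (hmin : M.IsMinimal) (h2 : M.IsTwoConnected) {x y : D}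
    (hx : CellMap.Cell.edge (M.edgeOf x) ∈ M.closedRegion (M.leftRegion y))
    (ho : M.origin x = M.origin y) : x = y ∨ x = M.next y := by
  obtain ⟨d, hd, hdx⟩ := M.edge_mem_closedRegion.1 hx
  rw [eq_comm, M.edgeOf_eq_iff] at hdx
  obtain rfl | rfl := hdx
  · exact Or.inl (eq_of_origin_of_leftRegion hmin h2 ho hd)
  · right
    rw [← Equiv.symm_apply_eq, ← CellMap.walk_rev]
    exact eq_of_origin_of_leftRegion hmin h2 (by simp [ho]) (by rwa [M.leftRegion_walk])

theorem connected_induce_of_closedRegion_inter (hmin : M.IsMinimal) (h2 : M.IsTwoConnected)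
    (H : ∀ R S : M.Region, R ≠ S →
      M.closedRegion R ∩ M.closedRegion S = ∅ ∨
      (∃ v : M.Vertex, M.closedRegion R ∩ M.closedRegion S = M.closedVertex v) ∨
      (∃ e : M.Edge, M.closedRegion R ∩ M.closedRegion S = M.closedEdge e))
    {u v : M.Vertex} (huv : u ≠ v) :
    (M.graph.induce {w | w ∉ ({u, v} : Finset M.Vertex)}).Preconnected := by
  set s : Set M.Vertex := {w | w ∉ ({u, v} : Finset M.Vertex)} with hs
  have hmem : ∀ w, w ∈ s ↔ w ≠ u ∧ w ≠ v := fun w => by simp [hs]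
  intro a b
  by_contra hab
  -- the vertices in the component of `a`, and those in the other components
  set A : M.Vertex → Prop := fun w => ∃ h : w ∈ s, (M.graph.induce s).Reachable a ⟨w, h⟩ with hA
  set B : M.Vertex → Prop := fun w => w ∈ s ∧ ¬A w with hB
  have hAd : ∀ d, A (M.origin d) → M.origin (M.rev d) ∈ s → A (M.origin (M.rev d)) := by
    rintro d ⟨h, hr⟩ h'
    by_cases heq : M.origin d = M.origin (M.rev d)
    · rw [← heq]; exact ⟨h, hr⟩
    · exact ⟨h', hr.trans (SimpleGraph.Adj.reachable ⟨heq, d, rfl, rfl⟩)⟩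
  have hBd : ∀ d, B (M.origin d) → M.origin (M.rev d) ∈ s → B (M.origin (M.rev d)) := by
    rintro d ⟨h, hr⟩ h'
    refine ⟨h', fun hA' => hr ?_⟩
    have := hAd (M.rev d) hA'
    rw [M.rev_rev] at this
    exact this h
  have hconn := (h2.2 {v} (by simp)).preconnected
  -- With `v` alone removed, a path leads from `C` to `u`, and it can leave `C` only by stepping to
  -- `u`.
  have hneigh : ∀ C : M.Vertex → Prop, (∀ w, C w → w ∈ s) → (∃ w, C w) →
      (∀ d, C (M.origin d) → M.origin (M.rev d) ∈ s → C (M.origin (M.rev d))) →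
      ∃ d, M.origin d = u ∧ C (M.origin (M.rev d)) := by
    rintro C hCs ⟨w, hw⟩ hCd
    obtain ⟨⟨x, hx⟩, ⟨y, hy⟩, ⟨-, d, rfl, rfl⟩, hCx, hCy⟩ := hconn.exists_adj_of_not
      (P := fun w => C w.1) (a := ⟨w, by simpa using ((hmem w).1 (hCs w hw)).2⟩)
      (b := ⟨u, by simpa using huv⟩) hw (fun hu => ((hmem u).1 (hCs u hu)).1 rfl)
    refine ⟨M.rev d, ?_, by rwa [M.rev_rev]⟩
    by_contra hne
    exact hCy (hCd d hCx ((hmem _).2 ⟨hne, by simpa using hy⟩))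
  obtain ⟨a₀, ha₀, hAa⟩ := hneigh A (fun w h => h.1) ⟨a, a.2, SimpleGraph.Reachable.refl _⟩ hAd
  obtain ⟨b₀, hb₀, hBb⟩ := hneigh B (fun w h => h.1) ⟨b, b.2, fun h => hab h.2⟩ hBd
  have huB : ¬B u := fun h => ((hmem u).1 h.1).1 rfl
  have hvB : ¬B v := fun h => ((hmem v).1 h.1).2 rfl
  -- `P` holds for the edges with an end in `B`; it can change only around `u` and `v`.
  set P : D → Prop := fun d => B (M.origin d) ∨ B (M.origin (M.rev d)) with hP
  have hPrev : ∀ d, P (M.rev d) ↔ P d := fun d => by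
    simp only [hP, M.rev_rev]; exact or_comm
  have hPnot : ∀ d, A (M.origin d) → ¬P d := by
    rintro d hd (h | h)
    · exact h.2 hd
    · exact h.2 (hAd d hd h.1)
  have hPnext : ∀ d, M.origin d ≠ u → M.origin d ≠ v → (P (M.next d) ↔ P d) := by
    intro d hu hv
    by_cases hd : A (M.origin d)
    · exact iff_of_false (hPnot _ (by rwa [M.origin_next])) (hPnot _ hd)
    · have : B (M.origin d) := ⟨(hmem _).2 ⟨hu, hv⟩, hd⟩
      exact iff_of_true (Or.inl (by rwa [M.origin_next])) (Or.inl this)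
  have hPa : ¬P a₀ := by rw [← hPrev]; exact hPnot _ hAa
  have hPb : P b₀ := Or.inr hBb
  have hcyc : M.next.SameCycle a₀ b₀ := M.origin_eq_iff.1 (ha₀.trans hb₀.symm)
  have hopow : ∀ i : ℕ, M.origin ((M.next ^ i) a₀) = u := fun i => by
    rw [← ha₀, M.origin_eq_iff]
    exact Equiv.Perm.sameCycle_pow_left.2 (Equiv.Perm.SameCycle.refl _ _)
  have hopow' : ∀ i : ℕ, M.origin ((M.next⁻¹ ^ i) a₀) = u := fun i => by
    rw [← ha₀, M.origin_eq_iff, ← Equiv.Perm.sameCycle_inv]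
    exact Equiv.Perm.sameCycle_pow_left.2 (Equiv.Perm.SameCycle.refl _ _)
  -- The maximal run of darts at `u` around `a₀` that avoid `B` reaches from `x` counterclockwise to
  -- `y`. The changes of `P` are at the corners of `y` and of `t`, the dart just before `x`.
  obtain ⟨m, hm, hm'⟩ := hcyc.exists_first hPa hPb
  obtain ⟨n, hn, hn'⟩ := (Equiv.Perm.sameCycle_inv.2 hcyc).exists_first hPa hPb
  set y := (M.next ^ m) a₀ with hy
  set x := (M.next⁻¹ ^ n) a₀ with hx
  set t := M.next⁻¹ x with ht
  have hty : M.next t = x := by simp [ht]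
  have hPy : ¬P y := hm m le_rfl
  have hPx : ¬P x := hn n le_rfl
  have hoy : M.origin y = u := hopow m
  have hox : M.origin x = u := hopow' n
  have hot : M.origin t = u := by rw [← M.origin_next, hty, hox]
  have hRS : M.leftRegion y ≠ M.leftRegion t := fun h => by
    have := eq_of_origin_of_leftRegion hmin h2 (hoy.trans hot.symm) h
    exact hPy (this ▸ hn')
  obtain ⟨p, hp, hpv⟩ := exists_corner_of_change hmin h2 hPrev (v := v) (y := y)
    (by rwa [hoy]) (fun h => hPy (h.1 hm'))
  obtain ⟨q, hq, hqv⟩ := exists_corner_of_change hmin h2 hPrev (v := v) (y := t)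
    (by rwa [hot]) (fun h => hPx (hty ▸ h.2 hn'))
  have hu : CellMap.Cell.vertex u ∈ M.closedRegion (M.leftRegion y) ∩
      M.closedRegion (M.leftRegion t) :=
    ⟨M.vertex_mem_closedRegion.2 ⟨y, rfl, hoy⟩, M.vertex_mem_closedRegion.2 ⟨t, rfl, hot⟩⟩
  have hv : CellMap.Cell.vertex v ∈ M.closedRegion (M.leftRegion y) ∩
      M.closedRegion (M.leftRegion t) :=
    ⟨M.vertex_mem_closedRegion.2 ⟨p, hp, hpv⟩, M.vertex_mem_closedRegion.2 ⟨q, hq, hqv⟩⟩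
  obtain h | ⟨w, h⟩ | ⟨e, h⟩ := H _ _ hRS
  · rw [h] at hu
    exact hu
  · rw [h] at hu hv
    cases hu
    cases hv
    exact huv rfl
  · obtain ⟨ε, rfl, hεu, hεv⟩ : ∃ ε, M.edgeOf ε = e ∧ M.origin ε = u ∧
        M.origin (M.rev ε) = v := by
      obtain ⟨ε, rfl⟩ := M.edgeOf_surjective e
      rw [h, M.vertex_mem_closedEdge] at hu hv
      obtain hu | hu := hu <;> obtain hv | hv := hv
      · exact (huv (hu.trans hv.symm)).elim
      · exact ⟨ε, rfl, hu.symm, hv.symm⟩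
      · exact ⟨M.rev ε, by simp, hu.symm, by rw [M.rev_rev, hv]⟩
      · exact (huv (hu.trans hv.symm)).elim
    have hPε : ¬P ε := by
      simp only [hP, hεu, hεv]
      exact not_or.2 ⟨huB, hvB⟩
    have he := (Set.ext_iff.1 h (CellMap.Cell.edge (M.edgeOf ε))).2
      (M.edge_mem_closedEdge.2 rfl)
    -- The shared edge avoids `B` and bounds both corners, so it is both `y` and `x`.
    have hεy : ε = y := (eq_or_eq_next_of_edge_mem hmin h2 he.1 (hεu.trans hoy.symm)).resolve_right
      fun h => hPε (h ▸ hm')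
    have hεx : ε = x := ((eq_or_eq_next_of_edge_mem hmin h2 he.2
      (hεu.trans hot.symm)).resolve_left fun h => hPε (h ▸ hn')).trans hty
    -- Now the run is a single dart. Either it is `a₀`, whose far end lies in `A` and is not `v`, or
    -- the dart after `x` belongs to the run, although the dart after `y` touches `B`.
    cases n with
    | zero =>
      have : ε = a₀ := hεx
      rw [← this, hεv] at hAa
      exact ((hmem v).1 hAa.1).2 rfl
    | succ k =>
      refine hn k (Nat.le_succ k) ?_
      rw [← hεy, hεx, hx, pow_succ', Equiv.Perm.mul_apply, Equiv.Perm.inv_def,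
        Equiv.apply_symm_apply] at hm'
      exact hm'

end PlanarDoodle

theorem theorem4p2 {D : Type*} [Finite D] (M : PlanarDoodle D)
    (hmin : M.IsMinimal) (h2 : M.IsTwoConnected) :
    M.IsPrime ↔
      ∀ R S : M.Region, R ≠ S →
        M.closedRegion R ∩ M.closedRegion S = ∅ ∨
        (∃ v : M.Vertex, M.closedRegion R ∩ M.closedRegion S = M.closedVertex v) ∨
        (∃ e : M.Edge, M.closedRegion R ∩ M.closedRegion S = M.closedEdge e) := by
  have hcard := hmin.six_le_card_vertex
  refine ⟨fun h3 R S hRS => h3.closedRegion_inter hmin h2 hRS,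
    fun H => ⟨by omega, fun X hX => ?_⟩⟩
  by_cases hX' : X.card < 2
  · exact h2.2 X hX'
  · obtain ⟨u, v, huv, rfl⟩ := Finset.card_eq_two.1 (by omega : X.card = 2)
    have : Nonempty {w | w ∉ ({u, v} : Finset M.Vertex)} := by
      by_contra hc
      have := Fintype.ofFinite M.Vertex
      have hsub : (Finset.univ : Finset M.Vertex) ⊆ {u, v} := fun w _ => by
        by_contra hw
        exact hc ⟨w, hw⟩
      have := Finset.card_le_card hsub
      rw [Finset.card_univ, ← Nat.card_eq_fintype_card] at this
      omega
    exact ⟨PlanarDoodle.connected_induce_of_closedRegion_inter hmin h2 H huv⟩
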